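/- A signed graph $\Gamma=(G,\sigma)$ is a finite simple graph $G$ with a function $\sigma:E(G)\to\{+1,-1\}$. Its adjacency matrix $A(\Gamma)$ has entry $\sigma(uv)$ at $(u,v)$ if $uv\in E(G)$ and $0$ otherwise; its nullity $\eta(\Gamma)$ is the number of zero eigenvalues of $A(\Gamma)$, counted with multiplicity; $p(\Gamma)$ is the number of vertices of degree $1$ of $G$; and $\theta(\Gamma)=|E(G)|-|V(G)|+c(G)$, where $c(G)$ is the number of connected components of $G$. A signed graph is balanced if the product of the edge signs along each of its cycles is $+1$, and unbalanced otherwise. An isomorphism of signed graphs is an isomorphism of the underlying graphs that preserves the signs of the edges. Let $\Gamma$ be a signed graph of order $n$, each connected component of which has at least two vertices. Then $\eta(\Gamma)=p(\Gamma)+2\theta(\Gamma)$ if and only if $\Gamma$ is isomorphic to a disjoint union $C_{n_1}^{\sigma}\cup C_{n_2}^{\sigma}\cup\cdots\cup C_{n_t}^{\sigma}$ of signed cycles, with $n_i\ge 3$ vertices each and $n_1+n_2+\cdots+n_t=n$, such that for every $i\in\{1,\ldots,t\}$, $n_i\equiv 0 \pmod 4$ if $C_{n_i}^{\sigma}$ is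 balanced and $n_i\equiv 2 \pmod 4$ if $C_{n_i}^{\sigma}$ is unbalanced. -/

import Mathlib

/-- A signed graph `Γ = (G, σ)` on the vertex set `V`: a simple graph `G` together with a sign
function on its edges; the signs `+` and `-` are the units `1` and `-1` of `ℤ`. -/
structure SignedGraph (V : Type*) where
  /-- the underlying simple graph -/
  graph : SimpleGraph V
  /-- the sign function `σ : E(G) → {+, -}` -/
  sign : graph.edgeSet → ℤˣ

namespace SignedGraph

/-- The adjacency matrix of a signed graph: the entry at `(u, v)` is the sign of the edge `uv`
if there is one, and `0` otherwise. -/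
noncomputable def adjMatrix {V : Type*} (Γ : SignedGraph V) : Matrix V V ℝ :=
  open Classical in
  Matrix.of fun u v =>
    if h : Γ.graph.Adj u v then (((Γ.sign ⟨s(u, v), h⟩ : ℤˣ) : ℤ) : ℝ) else 0

theorem isHermitian_adjMatrix {V : Type*} (Γ : SignedGraph V) : Γ.adjMatrix.IsHermitian := by
  ext u v
  by_cases h : Γ.graph.Adj u v
  · have h' := h.symm
    have e : (⟨s(v, u), h'⟩ : Γ.graph.edgeSet) = ⟨s(u, v), h⟩ := Subtype.ext Sym2.eq_swap
    simp [adjMatrix, h, h', e]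
  · have h' : ¬ Γ.graph.Adj v u := fun k => h k.symm
    simp [adjMatrix, h, h']

/-- The nullity `η(Γ)`: the number of zero eigenvalues of the adjacency matrix, counted with
multiplicity (`eigenvalues` lists all `|V|` eigenvalues with multiplicity). -/
noncomputable def nullity {V : Type*} [Fintype V] [DecidableEq V] (Γ : SignedGraph V) : ℕ :=
  Nat.card {i : V // Γ.isHermitian_adjMatrix.eigenvalues i = 0}

/-- The number `p(Γ)` of pendant vertices, that is, of vertices of degree `1`. -/
noncomputable def numPendant {V : Type*} (Γ : SignedGraph V) : ℕ :=
  Nat.card {v : V // (Γ.graph.neighborSet v).ncard = 1}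

/-- The cyclomatic number `θ(Γ) = |E| - |V| + c`, where `c` is the number of connected
components. -/
noncomputable def cyclomaticNumber {V : Type*} (Γ : SignedGraph V) : ℤ :=
  (Nat.card Γ.graph.edgeSet : ℤ) - Nat.card V + Nat.card Γ.graph.ConnectedComponent

/-- The sign of a walk: the product of the signs of the edges it traverses. For a cycle, which
traverses each of its edges once, this is the product over the edge set of the cycle. -/
def walkSign {V : Type*} (Γ : SignedGraph V) {u v : V} (w : Γ.graph.Walk u v) : ℤˣ :=
  (w.darts.map fun d => Γ.sign ⟨d.edge, d.edge_mem⟩).prod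

/-- A signed graph is balanced if all of its cycles are positive. -/
def Balanced {V : Type*} (Γ : SignedGraph V) : Prop :=
  ∀ (v : V) (w : Γ.graph.Walk v v), w.IsCycle → Γ.walkSign w = 1

/-- Two signed graphs are isomorphic if some isomorphism of the underlying graphs preserves the
sign of every edge. -/
def Isomorphic {V W : Type*} (Γ : SignedGraph V) (Δ : SignedGraph W) : Prop :=
  ∃ φ : Γ.graph ≃g Δ.graph, ∀ e : Γ.graph.edgeSet, Δ.sign (φ.mapEdgeSet e) = Γ.sign e

/-- The signed cycle `C_n^σ` of length `n` (a cycle for `3 ≤ n`). -/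
def cycle (n : ℕ) (σ : (SimpleGraph.cycleGraph n).edgeSet → ℤˣ) : SignedGraph (Fin n) where
  graph := SimpleGraph.cycleGraph n
  sign := σ

/-- The disjoint union of a family of graphs. -/
def graphUnion {ι : Type*} {V : ι → Type*} (G : ∀ i, SimpleGraph (V i)) :
    SimpleGraph (Σ i, V i) :=
  ⨆ i, (G i).map (Function.Embedding.sigmaMk i)

theorem exists_of_mem_graphUnion {ι : Type*} {V : ι → Type*} {G : ∀ i, SimpleGraph (V i)}
    (e : (graphUnion G).edgeSet) :
    ∃ f : Σ i, (G i).edgeSet, Sym2.map (Sigma.mk f.1) f.2.1 = e.1 := by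
  obtain ⟨e, he⟩ := e
  simp only [graphUnion, SimpleGraph.edgeSet_iSup, Set.mem_iUnion, SimpleGraph.edgeSet_map] at he
  obtain ⟨i, f, hf, rfl⟩ := he
  exact ⟨⟨i, f, hf⟩, rfl⟩

/-- The disjoint union of a family of signed graphs: every edge of the union is the copy of an
edge of exactly one member of the family and keeps its sign. -/
noncomputable def disjUnion {ι : Type*} {V : ι → Type*} (Γ : ∀ i, SignedGraph (V i)) :
    SignedGraph (Σ i, V i) where
  graph := graphUnion fun i => (Γ i).graph
  sign e := (Γ (exists_of_mem_graphUnion e).choose.1).sign (exists_of_mem_graphUnion e).choose.2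

/-- The edge of the union that is the copy of the edge `e` of the `i`-th graph has the sign
of `e`. -/
theorem disjUnion_sign {ι : Type*} {V : ι → Type*} (Γ : ∀ i, SignedGraph (V i)) (i : ι)
    (e : (Γ i).graph.edgeSet) (h : Sym2.map (Sigma.mk i) e.1 ∈ (disjUnion Γ).graph.edgeSet) :
    (disjUnion Γ).sign ⟨Sym2.map (Sigma.mk i) e.1, h⟩ = (Γ i).sign e := by
  have key : ∀ f : Σ j, (Γ j).graph.edgeSet,
      Sym2.map (Sigma.mk f.1) f.2.1 = Sym2.map (Sigma.mk i) e.1 →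
      (Γ f.1).sign f.2 = (Γ i).sign e := by
    rintro ⟨j, f⟩ hf
    have hij : j = i := by
      obtain ⟨f, hf'⟩ := f
      obtain ⟨e, he'⟩ := e
      induction f using Sym2.ind with | _ a b =>
      induction e using Sym2.ind with | _ c d =>
      have : (⟨j, a⟩ : Σ i, V i) ∈ Sym2.map (Sigma.mk i) s(c, d) := by
        rw [← hf]; simp
      simp only [Sym2.map_mk, Sym2.mem_iff] at this
      rcases this with h | h <;> exact congrArg Sigma.fst h
    subst hij
    have : f = e := Subtype.ext (Sym2.map.injective sigma_mk_injective hf)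
    rw [this]
  exact key _ (exists_of_mem_graphUnion (G := fun i => (Γ i).graph)
    ⟨Sym2.map (Sigma.mk i) e.1, h⟩).choose_spec

end SignedGraph

/-!
If `A` is the adjacency matrix, `x` a vector with `A x = 0` and `v` a vertex at which `x` vanishes,
as it does at all but one neighbour of `v`, then `x` also vanishes at that last neighbour. Hence the
nullity is at most the size of a zero forcing set, one from which repeating this step reaches every
vertex. A connected graph without isolated vertices is explored from any vertex of degree `d` at a
cost of `d` initial vertices, and then passing through a vertex of degree `d` costs `d - 2` more; in
total this is `2 + ∑ (d - 2)` (truncated subtraction), and summed over the components it equals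
`p + 2θ`. A pendant vertex makes the start cheaper, and a vertex of degree at least three on a cycle
is left along an edge whose end is reached anyway; so equality forces all degrees to be two.

On a cycle with `n` vertices and product of signs `ε`, multiplying by partial products of signs
turns kernel vectors into the sequences with `Y (k + 2) = -Y k` and `Y (k + n) = ε Y k`. The nullity
is two exactly when `Y 0` and `Y 1` are arbitrary, that is, when `n = 2l` and `ε = (-1) ^ l`.
-/

section ZeroForcing

open SimpleGraph Module

variable {V : Type*} {G : SimpleGraph V}

/-- The vertices that the zero forcing process started at `S` reaches: a reached vertex `v` all of
whose neighbours except `u` have been reached forces `u`. -/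
inductive ZeroForced (G : SimpleGraph V) (S : Set V) : V → Prop
  | of_mem {v : V} (hv : v ∈ S) : ZeroForced G S v
  | force {v u : V} (hv : ZeroForced G S v) (hvu : G.Adj v u)
      (hw : ∀ w, G.Adj v w → w ≠ u → ZeroForced G S w) : ZeroForced G S u

/-- A zero forcing set: the forcing process started at `S` reaches every vertex. -/
def IsZeroForcing (G : SimpleGraph V) (S : Set V) : Prop :=
  ∀ v, ZeroForced G S v

theorem ZeroForced.trans {S T : Set V} (hST : ∀ v ∈ S, ZeroForced G T v) {v : V}
    (hv : ZeroForced G S v) : ZeroForced G T v := by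
  induction hv with
  | of_mem hv => exact hST _ hv
  | force _ hvu _ ihv ihw => exact .force ihv hvu ihw

variable [Fintype V] {K : Type*} [Field K] {A : Matrix V V K}

theorem ZeroForced.apply_eq_zero (hA : ∀ v w, v ≠ w → (A v w ≠ 0 ↔ G.Adj v w)) {S : Set V}
    {x : V → K} (hx : A.mulVec x = 0) (hS : ∀ v ∈ S, x v = 0) {v : V} (hv : ZeroForced G S v) :
    x v = 0 := by
  induction hv with
  | of_mem hv => exact hS _ hv
  | @force v u _ hvu _ ihv ihw =>
    have hrow : A.mulVec x v = A v u * x u := by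
      refine Finset.sum_eq_single u (fun w _ hwu => ?_) (by simp)
      by_cases hvw : G.Adj v w
      · exact mul_eq_zero_of_right _ (ihw w hvw hwu)
      by_cases h : v = w
      · exact mul_eq_zero_of_right _ (h ▸ ihv)
      · exact mul_eq_zero_of_left (not_not.1 (mt (hA v w h).1 hvw)) _
    rw [hx, Pi.zero_apply, eq_comm] at hrow
    exact (mul_eq_zero.1 hrow).resolve_left ((hA v u hvu.ne).2 hvu)

/-- The restriction to `S` of the vectors in the kernel of `A`. -/
def kerRestrict (A : Matrix V V K) (S : Finset V) : LinearMap.ker A.mulVecLin →ₗ[K] (S → K) :=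
  LinearMap.funLeft K K Subtype.val ∘ₗ (LinearMap.ker A.mulVecLin).subtype

theorem IsZeroForcing.kerRestrict_injective {S : Finset V} (hS : IsZeroForcing G S)
    (hA : ∀ v w, v ≠ w → (A v w ≠ 0 ↔ G.Adj v w)) : Function.Injective (kerRestrict A S) := by
  rw [injective_iff_map_eq_zero]
  rintro ⟨x, hx⟩ hxS
  ext v
  exact (hS v).apply_eq_zero hA hx fun w hw => congrFun hxS ⟨w, hw⟩

theorem IsZeroForcing.finrank_ker_le_card {S : Finset V} (hS : IsZeroForcing G S)
    (hA : ∀ v w, v ≠ w → (A v w ≠ 0 ↔ G.Adj v w)) :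
    finrank K (LinearMap.ker A.mulVecLin) ≤ S.card := by
  simpa using LinearMap.finrank_le_finrank_of_injective (hS.kerRestrict_injective hA)

theorem IsZeroForcing.finrank_ker_eq_card_iff {S : Finset V} (hS : IsZeroForcing G S)
    (hA : ∀ v w, v ≠ w → (A v w ≠ 0 ↔ G.Adj v w)) :
    finrank K (LinearMap.ker A.mulVecLin) = S.card ↔
      ∀ y : V → K, ∃ x : V → K, A.mulVec x = 0 ∧ ∀ v ∈ S, x v = y v := by
  classical
  have hinj := hS.kerRestrict_injective hA
  constructor
  · intro hcard y
    obtain ⟨⟨x, hx⟩, hxy⟩ := (LinearMap.injective_iff_surjective_of_finrank_eq_finrank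
      (by simpa using hcard)).1 hinj fun v => y v
    exact ⟨x, hx, fun v hv => congrFun hxy ⟨v, hv⟩⟩
  · intro h
    have hsurj : Function.Surjective (kerRestrict A S) := fun y => by
      obtain ⟨x, hx, hxy⟩ := h fun v => if hv : v ∈ S then y ⟨v, hv⟩ else 0
      exact ⟨⟨x, hx⟩, funext fun v => (hxy v v.2).trans (dif_pos v.2)⟩
    simpa using (LinearEquiv.ofBijective _ ⟨hinj, hsurj⟩).finrank_eq

end ZeroForcing

section ForcingCost

open SimpleGraph

variable {V : Type*} [DecidableEq V] {G : SimpleGraph V}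

/-- Adding at most `k` vertices to `B` yields a set that forces all of `C`. -/
def ForcesWith (G : SimpleGraph V) (k : ℕ) (B C : Finset V) : Prop :=
  ∃ F : Finset V, F.card ≤ k ∧ ∀ v ∈ C, ZeroForced G (B ∪ F : Finset V) v

theorem ForcesWith.refl (B : Finset V) : ForcesWith G 0 B B :=
  ⟨∅, le_rfl, fun _ hv => .of_mem (by simpa using hv)⟩

theorem ForcesWith.trans {k l : ℕ} {B C D : Finset V} (hBC : ForcesWith G k B C)
    (hCD : ForcesWith G l C D) : ForcesWith G (k + l) B D := by
  obtain ⟨F, hF, hFC⟩ := hBC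
  obtain ⟨F', hF', hFD⟩ := hCD
  refine ⟨F ∪ F', (Finset.card_union_le F F').trans (add_le_add hF hF'), fun v hv =>
    (hFD v hv).trans fun w hw => ?_⟩
  rcases Finset.mem_union.1 hw with hw | hw
  · exact (hFC w hw).trans fun a ha => .of_mem (by
      rw [← Finset.union_assoc]; exact Finset.mem_union_left F' ha)
  · exact .of_mem (by simp [hw])

variable [Fintype V]

theorem ForcesWith.exists_isZeroForcing {k : ℕ} {B : Finset V}
    (h : ForcesWith G k B Finset.univ) :
    ∃ S : Finset V, IsZeroForcing G S ∧ S.card ≤ B.card + k := by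
  obtain ⟨F, hF, hforced⟩ := h
  exact ⟨B ∪ F, fun v => hforced v (Finset.mem_univ v),
    (Finset.card_union_le B F).trans (Nat.add_le_add_left hF _)⟩

variable [DecidableRel G.Adj]

theorem forcesWith_union_neighborFinset {B : Finset V} {v : V} (hv : v ∈ B) :
    ForcesWith G ((G.neighborFinset v \ B).card - 1) B (B ∪ G.neighborFinset v) := by
  obtain hN | ⟨u, hu⟩ := (G.neighborFinset v \ B).eq_empty_or_nonempty
  · rw [Finset.union_eq_left.2 (Finset.sdiff_eq_empty_iff_subset.1 hN), hN]
    exact .refl B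
  refine ⟨(G.neighborFinset v \ B).erase u, (Finset.card_erase_of_mem hu).le, fun w hw => ?_⟩
  have hmem : ∀ w ∈ B ∪ G.neighborFinset v, w ≠ u →
      ZeroForced G (B ∪ (G.neighborFinset v \ B).erase u : Finset V) w := fun w hw hwu =>
    .of_mem (by
      simp only [Finset.coe_union, Set.mem_union, Finset.mem_coe, Finset.mem_erase,
        Finset.mem_sdiff, Finset.mem_union] at hw ⊢
      tauto)
  by_cases hwu : w = u
  · rw [Finset.mem_sdiff, mem_neighborFinset] at hu
    rw [hwu]
    exact .force (.of_mem (by simp [hv])) hu.1 fun w' hw' => hmem w' (by simp [hw'])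
  · exact hmem w hw hwu

/-- An upper bound on the number of neighbours of `v` that have to be added by hand, in addition
to the vertices of `B`, until `v` can force its last neighbour. A vertex outside `B` will be reached
through one of its neighbours, which leaves at most `degree v - 1` neighbours. -/
def forcingCost (G : SimpleGraph V) [DecidableRel G.Adj] (B : Finset V) (v : V) : ℕ :=
  if v ∈ B then (G.neighborFinset v \ B).card - 1 else G.degree v - 2

theorem forcingCost_of_notMem {B : Finset V} {v : V} (hv : v ∉ B) :
    forcingCost G B v = G.degree v - 2 :=
  if_neg hv

theorem forcingCost_of_mem_of_subset {B N : Finset V} {v : V} (hv : v ∈ B)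
    (hN : N ⊆ G.neighborFinset v) (hNB : N ⊆ B) :
    forcingCost G B v ≤ G.degree v - N.card - 1 := by
  have hcard : (G.neighborFinset v \ B).card ≤ (G.neighborFinset v \ N).card :=
    Finset.card_le_card (Finset.sdiff_subset_sdiff le_rfl hNB)
  rw [Finset.card_sdiff_of_subset hN, card_neighborFinset_eq_degree] at hcard
  rw [forcingCost, if_pos hv]
  exact Nat.sub_le_sub_right hcard 1

theorem forcingCost_le (B : Finset V) (v : V) :
    forcingCost G B v ≤ G.degree v - 2 + if v ∈ B then 1 else 0 := by
  by_cases hv : v ∈ B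
  · have := forcingCost_of_mem_of_subset (G := G) hv (Finset.empty_subset _)
      (Finset.empty_subset _)
    simp only [Finset.card_empty, hv, if_true] at this ⊢
    omega
  · simp [forcingCost_of_notMem, hv]

theorem forcingCost_union_neighborFinset_le {B : Finset V} {v : V} (hv : v ∈ B) (w : V) :
    forcingCost G (B ∪ G.neighborFinset v) w ≤ forcingCost G B w := by
  by_cases hw : w ∈ B
  · rw [forcingCost, forcingCost, if_pos hw, if_pos (Finset.mem_union_left _ hw)]
    exact Nat.sub_le_sub_right (Finset.card_le_card
      (Finset.sdiff_subset_sdiff le_rfl Finset.subset_union_left)) 1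
  rw [forcingCost_of_notMem hw]
  by_cases hvw : G.Adj v w
  · exact forcingCost_of_mem_of_subset (N := {v}) (by simp [hvw]) (by simpa using hvw.symm)
      (by simp [hv])
  · rw [forcingCost_of_notMem (by simp [hw, hvw])]

theorem add_sum_forcingCost_union_neighborFinset_le {W B : Finset V} {v : V} (hvW : v ∈ W)
    (hv : v ∈ B) :
    (G.neighborFinset v \ B).card - 1 + ∑ w ∈ W, forcingCost G (B ∪ G.neighborFinset v) w ≤
      ∑ w ∈ W, forcingCost G B w := by
  have hzero : forcingCost G (B ∪ G.neighborFinset v) v = 0 := by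
    simp [forcingCost, hv, Finset.sdiff_eq_empty_iff_subset.2 Finset.subset_union_right]
  have hcost : forcingCost G B v = (G.neighborFinset v \ B).card - 1 := if_pos hv
  rw [← Finset.add_sum_erase _ _ hvW, ← Finset.add_sum_erase _ (forcingCost G B) hvW, hzero,
    zero_add, hcost]
  exact Nat.add_le_add_left
    (Finset.sum_le_sum fun w _ => forcingCost_union_neighborFinset_le hv w) _

/-- The set `B` can be expanded to `C` by adding vertices whose number is paid for by the decrease
of the total forcing cost of the vertices in `W`. -/
def Expands (G : SimpleGraph V) [DecidableRel G.Adj] (W B C : Finset V) : Prop :=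
  B ⊆ C ∧ ∃ k, ForcesWith G k B C ∧
    k + ∑ w ∈ W, forcingCost G C w ≤ ∑ w ∈ W, forcingCost G B w

variable {W B C D : Finset V}

theorem Expands.refl (W B : Finset V) : Expands G W B B :=
  ⟨le_rfl, 0, .refl B, (zero_add _).le⟩

theorem Expands.trans (hBC : Expands G W B C) (hCD : Expands G W C D) : Expands G W B D := by
  obtain ⟨hBC, k, hk, hkle⟩ := hBC
  obtain ⟨hCD, l, hl, hlle⟩ := hCD
  exact ⟨hBC.trans hCD, k + l, hk.trans hl, by omega⟩

theorem expands_union_neighborFinset {v : V} (hvW : v ∈ W) (hv : v ∈ B) :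
    Expands G W B (B ∪ G.neighborFinset v) :=
  ⟨Finset.subset_union_left, _, forcesWith_union_neighborFinset hv,
    add_sum_forcingCost_union_neighborFinset_le hvW hv⟩

theorem exists_expands_of_walk {u x : V} (p : G.Walk u x) (hpW : ∀ w ∈ p.support, w ∈ W)
    (hu : u ∈ B) : ∃ C, x ∈ C ∧ Expands G W B C := by
  induction p generalizing B with
  | nil => exact ⟨B, hu, .refl W B⟩
  | @cons u v x huv p ih =>
    simp only [Walk.support_cons, List.mem_cons, forall_eq_or_imp] at hpW
    obtain ⟨C, hxC, hC⟩ := ih hpW.2 (B := B ∪ G.neighborFinset u) (by simp [huv])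
    exact ⟨C, hxC, (expands_union_neighborFinset hpW.1 hu).trans hC⟩

theorem exists_expands_of_reachable (hB : ∀ w, ∃ b ∈ B, G.Reachable b w) (T : Finset V) :
    ∃ C, T ⊆ C ∧ Expands G Finset.univ B C := by
  induction T using Finset.induction_on with
  | empty => exact ⟨B, Finset.empty_subset B, .refl _ B⟩
  | insert w T _ ih =>
    obtain ⟨C, hTC, hBC⟩ := ih
    obtain ⟨b, hb, ⟨p⟩⟩ := hB w
    obtain ⟨D, hwD, hCD⟩ := exists_expands_of_walk (W := Finset.univ) p (by simp) (hBC.1 hb)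
    exact ⟨D, Finset.insert_subset hwD (hTC.trans hCD.1), hBC.trans hCD⟩

theorem exists_forcesWith_univ_le (hB : ∀ w, ∃ b ∈ B, G.Reachable b w) :
    ∃ k ≤ ∑ w, forcingCost G B w, ForcesWith G k B Finset.univ := by
  obtain ⟨C, hC, -, k, hk, hkle⟩ := exists_expands_of_reachable hB Finset.univ
  rw [Finset.univ_subset_iff.1 hC] at hk
  exact ⟨k, by omega, hk⟩

/-- The set `B` is expanded along `p` without charging `z`, which is reached from `u`. Once `x` is
reached as well, two neighbours of `z` are known, one more than its cost accounts for. -/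
theorem exists_forcesWith_univ_lt (hB : ∀ w, ∃ b ∈ B, G.Reachable b w) {z u x : V} (hu : u ∈ B)
    (hz : z ∉ B) (hzu : G.Adj z u) (hzx : G.Adj z x) (hux : u ≠ x) (hdeg : 3 ≤ G.degree z)
    (p : G.Walk u x) (hp : z ∉ p.support) :
    ∃ k < ∑ w, forcingCost G B w, ForcesWith G k B Finset.univ := by
  obtain ⟨C, hxC, hexp⟩ := exists_expands_of_walk (W := Finset.univ.erase z) p
    (fun w hw => Finset.mem_erase.2 ⟨fun h => hp (h ▸ hw), Finset.mem_univ w⟩)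
    (Finset.mem_union_left (G.neighborFinset u) hu)
  have hzC : z ∈ C := hexp.1 (by simp [hzu.symm])
  have huC : u ∈ C := hexp.1 (Finset.mem_union_left _ hu)
  obtain ⟨hBC, k, hk, hkle⟩ :=
    (expands_union_neighborFinset (Finset.mem_erase.2 ⟨hzu.ne', Finset.mem_univ u⟩) hu).trans hexp
  obtain ⟨l, hlle, hl⟩ := exists_forcesWith_univ_le fun w =>
    (hB w).imp fun b hb => ⟨hBC hb.1, hb.2⟩
  have hcostC : forcingCost G C z ≤ G.degree z - 2 - 1 := by
    rw [← Finset.card_pair hux]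
    exact forcingCost_of_mem_of_subset hzC (by simp [Finset.insert_subset_iff, hzu, hzx])
      (by simp [Finset.insert_subset_iff, huC, hxC])
  have hcostB := forcingCost_of_notMem (G := G) hz
  refine ⟨k + l, ?_, hk.trans hl⟩
  rw [← Finset.add_sum_erase _ _ (Finset.mem_univ z)] at hlle ⊢
  omega

end ForcingCost

section Cycles

open SimpleGraph

variable {V : Type*} {G : SimpleGraph V}

theorem degree_eq_ncard_neighborSet (v : V) [Fintype (G.neighborSet v)] :
    G.degree v = (G.neighborSet v).ncard := by
  rw [← card_neighborSet_eq_degree, Set.ncard_eq_toFinset_card', Set.toFinset_card]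

theorem ncard_neighborSet_toSimpleGraph (c : G.ConnectedComponent) (a : c) :
    (c.toSimpleGraph.neighborSet a).ncard = (G.neighborSet (a : V)).ncard := by
  rw [← Set.ncard_image_of_injective _ Subtype.val_injective]
  congr 1
  ext w
  constructor
  · rintro ⟨b, hb, rfl⟩
    exact hb
  · exact fun hw => ⟨⟨w, (c.mem_supp_congr_adj hw).1 a.2⟩, hw, rfl⟩

theorem neighborSet_toSubgraph_eq_of_isCycle [Finite V] {a v : V} {p : G.Walk a a} (hp : p.IsCycle)
    (hv : v ∈ p.support) (hdeg : (G.neighborSet v).ncard ≤ 2) :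
    p.toSubgraph.neighborSet v = G.neighborSet v :=
  Set.eq_of_subset_of_ncard_le (p.toSubgraph.neighborSet_subset v)
    (by rwa [hp.ncard_neighborSet_toSubgraph_eq_two hv]) (Set.toFinite _)

theorem mem_support_of_isCycle [Finite V] (hG : G.Connected) {a : V} {p : G.Walk a a}
    (hp : p.IsCycle) (hdeg : ∀ v ∈ p.support, (G.neighborSet v).ncard ≤ 2) (w : V) :
    w ∈ p.support := by
  by_contra hw
  obtain ⟨q⟩ := hG.preconnected a w
  obtain ⟨d, -, hfst, hsnd⟩ :=
    q.exists_boundary_dart {v | v ∈ p.support} p.start_mem_support hw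
  have hadj : d.snd ∈ p.toSubgraph.neighborSet d.fst := by
    rw [neighborSet_toSubgraph_eq_of_isCycle hp hfst (hdeg _ hfst)]
    exact d.adj
  exact hsnd (Walk.mem_support_of_adj_toSubgraph (Subgraph.Adj.symm hadj))

theorem isEulerian_of_isCycle [Finite V] [DecidableEq V] (hG : G.Connected)
    (hdeg : ∀ v, (G.neighborSet v).ncard ≤ 2) {a : V} {p : G.Walk a a} (hp : p.IsCycle) :
    p.IsEulerian := by
  refine hp.isTrail.isEulerian_of_forall_mem fun e he => ?_
  induction e using Sym2.ind with | _ v w =>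
  rw [← Walk.mem_edges_toSubgraph, Subgraph.mem_edgeSet, ← Subgraph.mem_neighborSet,
    neighborSet_toSubgraph_eq_of_isCycle hp
      (mem_support_of_isCycle hG hp (fun v _ => hdeg v) v) (hdeg v)]
  exact he

theorem exists_isCycle_of_two_le_ncard_neighborSet [Finite V] (hG : G.Connected)
    (hdeg : ∀ v, 2 ≤ (G.neighborSet v).ncard) : ∃ (a : V) (p : G.Walk a a), p.IsCycle := by
  classical
  have := Fintype.ofFinite V
  by_contra! hacyclic
  obtain ⟨v⟩ := hG.nonempty
  obtain ⟨w, hw⟩ : (G.neighborSet v).Nonempty :=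
    Set.nonempty_of_ncard_ne_zero (Nat.ne_of_gt (zero_lt_two.trans_le (hdeg v)))
  have : Nontrivial V := ⟨v, w, hw.ne⟩
  obtain ⟨x, hx⟩ := IsTree.exists_vert_degree_one_of_nontrivial ⟨hG, fun a p => hacyclic a p⟩
  have := hdeg x
  rw [← degree_eq_ncard_neighborSet, hx] at this
  omega

theorem exists_isCycle_of_three_le_ncard_neighborSet [Finite V] (hG : G.Connected)
    (hdeg : ∀ v, 2 ≤ (G.neighborSet v).ncard) {v : V} (hv : 3 ≤ (G.neighborSet v).ncard) :
    ∃ (z : V) (p : G.Walk z z), p.IsCycle ∧ 3 ≤ (G.neighborSet z).ncard := by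
  classical
  obtain ⟨a, p, hp⟩ := exists_isCycle_of_two_le_ncard_neighborSet hG hdeg
  by_contra! hlt
  have hsupp : ∀ z ∈ p.support, (G.neighborSet z).ncard ≤ 2 := fun z hz =>
    Nat.le_of_lt_succ (hlt z (p.rotate z hz) (hp.rotate hz))
  exact (hv.trans (hsupp v (mem_support_of_isCycle hG hp hsupp v))).not_gt (by decide)

theorem exists_walk_of_isCycle {z : V} {p : G.Walk z z} (hp : p.IsCycle) :
    ∃ (u x : V) (q : G.Walk u x), G.Adj z u ∧ G.Adj z x ∧ u ≠ x ∧ z ∉ q.support := by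
  have hne := hp.snd_ne_penultimate
  cases p with
  | nil => exact absurd hp Walk.not_isCycle_nil
  | @cons _ u _ hzu q =>
    have hq : ¬ q.Nil := fun hq => hzu.ne' hq.eq
    have hadj := q.adj_penultimate hq
    rw [Walk.snd_cons, Walk.penultimate_cons_of_not_nil _ _ hq] at hne
    have hpath : (q.dropLast.concat hadj).IsPath := by
      rw [Walk.concat_dropLast]
      exact ((Walk.cons_isCycle_iff q hzu).1 hp).1
    exact ⟨u, q.penultimate, q.dropLast, hzu, hadj.symm, hne,
      ((Walk.concat_isPath_iff hadj).1 hpath).2⟩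

theorem exists_walk_of_three_le_ncard_neighborSet [Finite V]
    (hdeg : ∀ v, 2 ≤ (G.neighborSet v).ncard) {v : V} (hv : 3 ≤ (G.neighborSet v).ncard) :
    ∃ (z u x : V) (q : G.Walk u x), 3 ≤ (G.neighborSet z).ncard ∧ G.Adj z u ∧ G.Adj z x ∧
      u ≠ x ∧ z ∉ q.support := by
  let c := G.connectedComponentMk v
  obtain ⟨z, p, hp, hz⟩ := exists_isCycle_of_three_le_ncard_neighborSet c.connected_toSimpleGraph
    (fun a => (hdeg a).trans_eq (ncard_neighborSet_toSimpleGraph c a).symm) (v := ⟨v, rfl⟩)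
    (hv.trans_eq (ncard_neighborSet_toSimpleGraph c ⟨v, rfl⟩).symm)
  obtain ⟨u, x, q, hzu, hzx, hux, hq⟩ := exists_walk_of_isCycle
    (hp.map (f := c.toSimpleGraph_hom) Subtype.val_injective)
  rw [ncard_neighborSet_toSimpleGraph] at hz
  exact ⟨z, u, x, q, hz, hzu, hzx, hux, hq⟩

theorem ncard_neighborSet_cycleGraph {n : ℕ} (hn : 3 ≤ n) (v : Fin n) :
    ((cycleGraph n).neighborSet v).ncard = 2 := by
  obtain ⟨m, rfl⟩ := Nat.exists_eq_add_of_le' hn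
  rw [← degree_eq_ncard_neighborSet, cycleGraph_degree_three_le]

theorem nonempty_iso_of_injective_hom {W : Type*} [Finite V] [Nonempty W] {H : SimpleGraph W}
    (hG : G.Connected) (f : H →g G) (hf : Function.Injective f)
    (hdeg : ∀ a, (G.neighborSet (f a)).ncard ≤ (H.neighborSet a).ncard) : Nonempty (H ≃g G) := by
  have himage (a : W) : f '' H.neighborSet a = G.neighborSet (f a) :=
    Set.eq_of_subset_of_ncard_le (Set.image_subset_iff.2 fun b hb => f.map_adj hb)
      (by rw [Set.ncard_image_of_injective _ hf]; exact hdeg a) (Set.toFinite _)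
  have hadj {a : W} {v : V} (h : G.Adj (f a) v) : ∃ b, H.Adj a b ∧ f b = v := by
    rwa [← mem_neighborSet, ← himage] at h
  have hsurj : Function.Surjective f := by
    intro v
    by_contra hv
    obtain ⟨a⟩ := ‹Nonempty W›
    obtain ⟨p⟩ := hG.preconnected (f a) v
    obtain ⟨d, -, ⟨b, hb⟩, hd⟩ := p.exists_boundary_dart (Set.range f) ⟨a, rfl⟩ hv
    obtain ⟨c, -, hc⟩ := hadj (hb ▸ d.adj)
    exact hd ⟨c, hc⟩
  refine ⟨⟨Equiv.ofBijective f ⟨hf, hsurj⟩, fun {a b} => ⟨fun h => ?_, f.map_adj⟩⟩⟩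
  obtain ⟨c, hac, hc⟩ := hadj h
  exact hf hc ▸ hac

theorem exists_iso_cycleGraph [Finite V] (hG : G.Connected)
    (hdeg : ∀ v, (G.neighborSet v).ncard = 2) : ∃ n, 3 ≤ n ∧ Nonempty (cycleGraph n ≃g G) := by
  obtain ⟨a, p, hp⟩ := exists_isCycle_of_two_le_ncard_neighborSet hG fun v => (hdeg v).ge
  have hn := hp.three_le_length
  obtain ⟨f⟩ := (cycleGraph_isContained_iff (Nat.lt_of_succ_le hn)).2 ⟨a, p, hp, rfl⟩
  have : Nonempty (Fin p.length) := ⟨⟨0, by omega⟩⟩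
  exact ⟨p.length, hn, nonempty_iso_of_injective_hom hG f.toHom f.injective fun v => by
    rw [hdeg, ncard_neighborSet_cycleGraph hn]⟩

end Cycles

section NullityBound

open SimpleGraph

variable {V : Type*} {G : SimpleGraph V}

theorem exists_transversal [Finite V] (G : SimpleGraph V) (v : V) :
    ∃ B : Finset V, v ∈ B ∧ B.card ≤ Nat.card G.ConnectedComponent ∧
      (∀ w, ∃ b ∈ B, G.Reachable b w) ∧ ∀ b ∈ B, G.Reachable b v → b = v := by
  classical
  have := Fintype.ofFinite V
  let r : G.ConnectedComponent → V := Function.update Quot.out (G.connectedComponentMk v) v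
  have hr : ∀ c, G.connectedComponentMk (r c) = c :=
    Function.forall_update_iff Quot.out (p := fun c w => G.connectedComponentMk w = c) |>.2
      ⟨rfl, fun c _ => Quot.out_eq c⟩
  have hrv : r (G.connectedComponentMk v) = v := Function.update_self ..
  refine ⟨Finset.univ.image r, ?_, ?_, fun w => ?_, fun b hb hbv => ?_⟩
  · exact Finset.mem_image.2 ⟨_, Finset.mem_univ _, hrv⟩
  · rw [Nat.card_eq_fintype_card]
    exact Finset.card_image_le
  · exact ⟨r (G.connectedComponentMk w), Finset.mem_image_of_mem _ (Finset.mem_univ _),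
      ConnectedComponent.exact (hr _)⟩
  · obtain ⟨c, -, rfl⟩ := Finset.mem_image.1 hb
    rw [← hrv, ← ConnectedComponent.sound hbv, hr]

variable [Fintype V] [DecidableRel G.Adj]

theorem sum_degree_sub_two_add (hpos : ∀ v, 0 < G.degree v) :
    ∑ v, (G.degree v - 2) + 2 * Fintype.card V =
      2 * G.edgeFinset.card + (Finset.univ.filter fun v => G.degree v = 1).card := by
  have hsplit (v : V) : G.degree v - 2 + 2 = G.degree v + if G.degree v = 1 then 1 else 0 := by
    have := hpos v
    split_ifs <;> omega
  rw [← sum_degrees_eq_twice_card_edges, Finset.card_filter, ← Finset.sum_add_distrib,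
    ← Finset.sum_congr rfl fun v _ => hsplit v, Finset.sum_add_distrib, Finset.sum_const,
    Finset.card_univ, smul_eq_mul, mul_comm 2]

theorem sum_forcingCost_le [DecidableEq V] (B : Finset V) :
    ∑ w, forcingCost G B w ≤ B.card + ∑ w, (G.degree w - 2) := by
  refine (Finset.sum_le_sum fun w _ => forcingCost_le (G := G) B w).trans_eq ?_
  simp [Finset.sum_add_distrib, add_comm]

theorem sum_forcingCost_lt [DecidableEq V] {B : Finset V} {v : V} (hv : v ∈ B)
    (hdeg : G.degree v = 1) :
    ∑ w, forcingCost G B w < B.card + ∑ w, (G.degree w - 2) := by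
  have hlt : forcingCost G B v < G.degree v - 2 + if v ∈ B then 1 else 0 := by
    have := forcingCost_of_mem_of_subset (G := G) hv (Finset.empty_subset _)
      (Finset.empty_subset _)
    simp only [hv, hdeg, Finset.card_empty, if_true] at this ⊢
    omega
  refine (Finset.sum_lt_sum (fun w _ => forcingCost_le (G := G) B w)
    ⟨v, Finset.mem_univ v, hlt⟩).trans_eq ?_
  simp [Finset.sum_add_distrib, add_comm]

theorem exists_isZeroForcing_card_lt_of_degree_eq_one {v : V} (hv : G.degree v = 1) :
    ∃ S : Finset V, IsZeroForcing G S ∧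
      S.card < 2 * Nat.card G.ConnectedComponent + ∑ w, (G.degree w - 2) := by
  classical
  obtain ⟨B, hvB, hcard, hB, -⟩ := exists_transversal G v
  obtain ⟨k, hk, hforces⟩ := exists_forcesWith_univ_le hB
  obtain ⟨S, hS, hSle⟩ := hforces.exists_isZeroForcing
  have := sum_forcingCost_lt hvB hv
  exact ⟨S, hS, by omega⟩

theorem exists_isZeroForcing_card_lt_of_walk {z u x : V} (hz : 3 ≤ G.degree z) (hzu : G.Adj z u)
    (hzx : G.Adj z x) (hux : u ≠ x) (p : G.Walk u x) (hp : z ∉ p.support) :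
    ∃ S : Finset V, IsZeroForcing G S ∧
      S.card < 2 * Nat.card G.ConnectedComponent + ∑ w, (G.degree w - 2) := by
  classical
  obtain ⟨B, huB, hcard, hB, hBu⟩ := exists_transversal G u
  have hzB : z ∉ B := fun h => hzu.ne (hBu z h hzu.reachable)
  obtain ⟨k, hk, hforces⟩ := exists_forcesWith_univ_lt hB huB hzB hzu hzx hux hz p hp
  obtain ⟨S, hS, hSle⟩ := hforces.exists_isZeroForcing
  have := sum_forcingCost_le (G := G) B
  exact ⟨S, hS, by omega⟩

theorem exists_isZeroForcing_card_lt (hpos : ∀ v, 0 < G.degree v) {v : V} (hv : G.degree v ≠ 2) :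
    ∃ S : Finset V, IsZeroForcing G S ∧
      S.card < 2 * Nat.card G.ConnectedComponent + ∑ w, (G.degree w - 2) := by
  by_cases hpendant : ∃ w, G.degree w = 1
  · exact exists_isZeroForcing_card_lt_of_degree_eq_one hpendant.choose_spec
  have htwo (w : V) : 2 ≤ G.degree w :=
    Nat.lt_of_le_of_ne (hpos w) fun h => hpendant ⟨w, h.symm⟩
  simp only [degree_eq_ncard_neighborSet] at htwo hv
  obtain ⟨z, u, x, p, hz, hzu, hzx, hux, hp⟩ :=
    exists_walk_of_three_le_ncard_neighborSet htwo (Nat.lt_of_le_of_ne (htwo v) hv.symm)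
  rw [← degree_eq_ncard_neighborSet] at hz
  exact exists_isZeroForcing_card_lt_of_walk hz hzu hzx hux p hp

end NullityBound

section BlockDiagonal

open Module

variable {ι : Type*} [Fintype ι] [DecidableEq ι] {n : ι → Type*} [∀ i, Fintype (n i)]

theorem mulVec_blockDiagonal'_apply {R : Type*} [NonUnitalNonAssocSemiring R]
    (M : ∀ i, Matrix (n i) (n i) R) (x : (Σ i, n i) → R) (i : ι) (a : n i) :
    (Matrix.blockDiagonal' M).mulVec x ⟨i, a⟩ = (M i).mulVec (fun b => x ⟨i, b⟩) a := by
  rw [Matrix.mulVec, dotProduct, Fintype.sum_sigma, Finset.sum_eq_single i _ (by simp)]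
  · simp only [Matrix.blockDiagonal'_apply_eq, Matrix.mulVec, dotProduct]
  · exact fun j _ hj => Finset.sum_eq_zero fun b _ => by
      rw [Matrix.blockDiagonal'_apply_ne _ _ _ hj.symm, zero_mul]

variable {K : Type*} [Field K] (M : ∀ i, Matrix (n i) (n i) K)

/-- A vector lies in the kernel of a block diagonal matrix if and only if each of its blocks lies
in the kernel of the corresponding diagonal block. -/
def kerBlockDiagonalEquiv :
    LinearMap.ker (Matrix.blockDiagonal' M).mulVecLin ≃ₗ[K]
      ∀ i, LinearMap.ker (M i).mulVecLin where
  toFun x i := ⟨fun a => x.1 ⟨i, a⟩, by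
    ext a
    exact (mulVec_blockDiagonal'_apply M x.1 i a).symm.trans (congrFun x.2 ⟨i, a⟩)⟩
  invFun y := ⟨fun z => (y z.1).1 z.2, by
    ext ⟨i, a⟩
    exact (mulVec_blockDiagonal'_apply M _ i a).trans (congrFun (y i).2 a)⟩
  map_add' _ _ := rfl
  map_smul' _ _ := rfl
  left_inv _ := rfl
  right_inv _ := rfl

theorem finrank_ker_blockDiagonal' :
    finrank K (LinearMap.ker (Matrix.blockDiagonal' M).mulVecLin) =
      ∑ i, finrank K (LinearMap.ker (M i).mulVecLin) := by
  rw [(kerBlockDiagonalEquiv M).finrank_eq, finrank_pi_fintype]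

end BlockDiagonal

namespace SignedGraph

open SimpleGraph Module

section Nullity

variable {V W : Type*} {Γ : SignedGraph V} {Δ : SignedGraph W}

theorem adjMatrix_apply_of_adj (Γ : SignedGraph V) {u v : V} (h : Γ.graph.Adj u v) :
    Γ.adjMatrix u v = (((Γ.sign ⟨s(u, v), h⟩ : ℤˣ) : ℤ) : ℝ) := by
  simp [adjMatrix, h]

theorem adjMatrix_apply_of_not_adj (Γ : SignedGraph V) {u v : V} (h : ¬ Γ.graph.Adj u v) :
    Γ.adjMatrix u v = 0 := by
  simp [adjMatrix, h]

theorem adjMatrix_ne_zero_iff (Γ : SignedGraph V) (u v : V) :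
    Γ.adjMatrix u v ≠ 0 ↔ Γ.graph.Adj u v := by
  by_cases h : Γ.graph.Adj u v
  · simp [adjMatrix_apply_of_adj, h]
  · simp [adjMatrix_apply_of_not_adj, h]

theorem adjMatrix_eq_submatrix (φ : Γ.graph ≃g Δ.graph)
    (hφ : ∀ e : Γ.graph.edgeSet, Δ.sign (φ.mapEdgeSet e) = Γ.sign e) :
    Γ.adjMatrix = Δ.adjMatrix.submatrix φ φ := by
  ext u v
  rw [Matrix.submatrix_apply]
  by_cases huv : Γ.graph.Adj u v
  · rw [adjMatrix_apply_of_adj _ huv, adjMatrix_apply_of_adj _ (φ.map_adj_iff.2 huv),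
      ← hφ ⟨s(u, v), huv⟩]
    rfl
  · rw [adjMatrix_apply_of_not_adj _ huv, adjMatrix_apply_of_not_adj _ (mt φ.map_adj_iff.1 huv)]

variable [Fintype V] [DecidableEq V] [Fintype W] [DecidableEq W]

theorem nullity_add_rank (Γ : SignedGraph V) : Γ.nullity + Γ.adjMatrix.rank = Fintype.card V := by
  rw [Γ.isHermitian_adjMatrix.rank_eq_card_non_zero_eigs, nullity, Nat.card_eq_fintype_card,
    Fintype.card_subtype_compl]
  exact Nat.add_sub_cancel' (Fintype.card_subtype_le _)

theorem nullity_eq_finrank (Γ : SignedGraph V) :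
    Γ.nullity = finrank ℝ (LinearMap.ker Γ.adjMatrix.mulVecLin) := by
  have hrank := LinearMap.finrank_range_add_finrank_ker Γ.adjMatrix.mulVecLin
  rw [finrank_fintype_fun_eq_card, ← Γ.nullity_add_rank, add_comm] at hrank
  exact (Nat.add_right_cancel hrank).symm

theorem Isomorphic.nullity_eq (h : Γ.Isomorphic Δ) : Γ.nullity = Δ.nullity := by
  obtain ⟨φ, hφ⟩ := h
  have hrank : Γ.adjMatrix.rank = Δ.adjMatrix.rank := by
    rw [adjMatrix_eq_submatrix φ hφ]
    exact Matrix.rank_submatrix Δ.adjMatrix φ.toEquiv φ.toEquiv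
  have hcard := Fintype.card_congr φ.toEquiv
  rw [← Γ.nullity_add_rank, ← Δ.nullity_add_rank, hrank] at hcard
  exact Nat.add_right_cancel hcard

theorem nullity_le_card_of_isZeroForcing {S : Finset V} (hS : IsZeroForcing Γ.graph S) :
    Γ.nullity ≤ S.card := by
  rw [nullity_eq_finrank]
  exact hS.finrank_ker_le_card fun v w _ => Γ.adjMatrix_ne_zero_iff v w

end Nullity

section DisjUnion

variable {ι : Type*} {V : ι → Type*} {G : ∀ i, SimpleGraph (V i)}

theorem graphUnion_adj {x y : Σ i, V i} :
    (graphUnion G).Adj x y ↔ ∃ i a b, (G i).Adj a b ∧ x = ⟨i, a⟩ ∧ y = ⟨i, b⟩ := by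
  simp only [graphUnion, iSup_adj, map_adj, Function.Embedding.sigmaMk_apply, eq_comm (a := x),
    eq_comm (a := y)]

theorem graphUnion_adj_mk {i : ι} {a b : V i} :
    (graphUnion G).Adj ⟨i, a⟩ ⟨i, b⟩ ↔ (G i).Adj a b := by
  rw [graphUnion_adj]
  refine ⟨?_, fun h => ⟨i, a, b, h, rfl, rfl⟩⟩
  rintro ⟨j, a', b', h, ha, hb⟩
  obtain rfl : i = j := congrArg Sigma.fst ha
  rwa [sigma_mk_injective ha, sigma_mk_injective hb]

/-- The inclusion of a member of a family of graphs into their disjoint union. -/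
def graphUnionEmbedding (G : ∀ i, SimpleGraph (V i)) (i : ι) : G i ↪g graphUnion G :=
  ⟨Function.Embedding.sigmaMk i, graphUnion_adj_mk⟩

theorem fst_eq_of_reachable_graphUnion {x y : Σ i, V i} (h : (graphUnion G).Reachable x y) :
    x.1 = y.1 := by
  obtain ⟨p⟩ := h
  induction p with
  | nil => rfl
  | cons h _ ih =>
    obtain ⟨i, a, b, -, rfl, rfl⟩ := graphUnion_adj.1 h
    exact ih

theorem card_connectedComponent_graphUnion (hG : ∀ i, (G i).Connected) :
    Nat.card (graphUnion G).ConnectedComponent = Nat.card ι := by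
  have (i : ι) : Nonempty (V i) := (hG i).nonempty
  refine (Nat.card_eq_of_bijective (fun i => (graphUnion G).connectedComponentMk
    ⟨i, Classical.arbitrary (V i)⟩) ⟨fun i j hij => ?_, fun c => ?_⟩).symm
  · exact fst_eq_of_reachable_graphUnion (ConnectedComponent.exact hij)
  · induction c using ConnectedComponent.ind with | _ v =>
    obtain ⟨i, a⟩ := v
    exact ⟨i, ConnectedComponent.sound
      (((hG i).preconnected _ a).map (graphUnionEmbedding G i).toHom)⟩

theorem ncard_neighborSet_graphUnion (i : ι) (a : V i) :
    ((graphUnion G).neighborSet ⟨i, a⟩).ncard = ((G i).neighborSet a).ncard := by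
  rw [← Set.ncard_image_of_injective _ (sigma_mk_injective (i := i))]
  congr 1
  ext x
  constructor
  · intro h
    obtain ⟨j, a', b, hab, ha, rfl⟩ := graphUnion_adj.1 h
    obtain rfl : i = j := congrArg Sigma.fst ha
    exact ⟨b, sigma_mk_injective ha ▸ hab, rfl⟩
  · rintro ⟨b, hb, rfl⟩
    exact graphUnion_adj_mk.2 hb

/-- Disjoint unions of families of isomorphic graphs, up to reindexing, are isomorphic. -/
def graphUnionCongr {κ : Type*} {W : κ → Type*} {H : ∀ k, SimpleGraph (W k)} (e : ι ≃ κ)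
    (ψ : ∀ i, G i ≃g H (e i)) : graphUnion G ≃g graphUnion H where
  toEquiv := Equiv.sigmaCongr e fun i => (ψ i).toEquiv
  map_rel_iff' {x y} := by
    obtain ⟨i, a⟩ := x
    obtain ⟨j, b⟩ := y
    constructor
    · intro h
      obtain rfl : i = j := e.injective (fst_eq_of_reachable_graphUnion h.reachable)
      exact graphUnion_adj_mk.2 ((ψ i).map_adj_iff.1 (graphUnion_adj_mk.1 h))
    · intro h
      obtain rfl : i = j := fst_eq_of_reachable_graphUnion h.reachable
      exact graphUnion_adj_mk.2 ((ψ i).map_adj_iff.2 (graphUnion_adj_mk.1 h))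

/-- A graph is the disjoint union of its connected components. -/
def graphUnionComponentsIso {W : Type*} (G : SimpleGraph W) :
    graphUnion (fun c : G.ConnectedComponent => c.toSimpleGraph) ≃g G where
  toFun x := x.2
  invFun w := ⟨G.connectedComponentMk w, w, rfl⟩
  left_inv := by
    rintro ⟨c, w, rfl⟩
    rfl
  right_inv _ := rfl
  map_rel_iff' {x y} := by
    obtain ⟨c, v, hv⟩ := x
    obtain ⟨d, w, hw⟩ := y
    refine ⟨fun h => ?_, fun h => ?_⟩
    · obtain rfl : c = d := hv.symm.trans ((ConnectedComponent.sound h.reachable).trans hw)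
      exact graphUnion_adj_mk.2 h
    · obtain rfl : c = d := fst_eq_of_reachable_graphUnion h.reachable
      exact graphUnion_adj_mk.1 h

theorem exists_iso_graphUnion_cycleGraph {W : Type*} [Finite W] (G : SimpleGraph W)
    (hdeg : ∀ v, (G.neighborSet v).ncard = 2) :
    ∃ (t : ℕ) (n : Fin t → ℕ), (∀ i, 3 ≤ n i) ∧
      Nonempty (graphUnion (fun i => cycleGraph (n i)) ≃g G) := by
  have hcomponent (c : G.ConnectedComponent) :
      ∃ n, 3 ≤ n ∧ Nonempty (cycleGraph n ≃g c.toSimpleGraph) :=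
    exists_iso_cycleGraph c.connected_toSimpleGraph fun a =>
      (ncard_neighborSet_toSimpleGraph c a).trans (hdeg a)
  choose n hn ψ using hcomponent
  obtain ⟨t, ⟨e⟩⟩ := Finite.exists_equiv_fin G.ConnectedComponent
  exact ⟨t, fun i => n (e.symm i), fun i => hn _,
    ⟨(graphUnionCongr e.symm fun i => (ψ (e.symm i)).some).trans (graphUnionComponentsIso G)⟩⟩

theorem adjMatrix_disjUnion [DecidableEq ι] (Γ : ∀ i, SignedGraph (V i)) :
    (disjUnion Γ).adjMatrix = Matrix.blockDiagonal' fun i => (Γ i).adjMatrix := by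
  ext ⟨i, a⟩ ⟨j, b⟩
  by_cases hij : i = j
  · subst hij
    rw [Matrix.blockDiagonal'_apply_eq]
    by_cases h : (Γ i).graph.Adj a b
    · have h' : (disjUnion Γ).graph.Adj ⟨i, a⟩ ⟨i, b⟩ := graphUnion_adj_mk.2 h
      rw [adjMatrix_apply_of_adj _ h, adjMatrix_apply_of_adj _ h',
        ← disjUnion_sign Γ i ⟨s(a, b), h⟩ h']
      rfl
    · rw [adjMatrix_apply_of_not_adj _ h,
        adjMatrix_apply_of_not_adj _ (mt graphUnion_adj_mk.1 h)]
  · rw [Matrix.blockDiagonal'_apply_ne _ _ _ hij, adjMatrix_apply_of_not_adj]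
    exact fun h => hij (fst_eq_of_reachable_graphUnion h.reachable)

theorem nullity_disjUnion [Fintype ι] [DecidableEq ι] [∀ i, Fintype (V i)]
    [∀ i, DecidableEq (V i)] (Γ : ∀ i, SignedGraph (V i)) :
    (disjUnion Γ).nullity = ∑ i, (Γ i).nullity := by
  rw [nullity_eq_finrank, adjMatrix_disjUnion, finrank_ker_blockDiagonal']
  exact Finset.sum_congr rfl fun i _ => (nullity_eq_finrank _).symm

theorem Isomorphic.symm {W W' : Type*} {Γ : SignedGraph W} {Δ : SignedGraph W'}
    (h : Γ.Isomorphic Δ) : Δ.Isomorphic Γ := by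
  obtain ⟨φ, hφ⟩ := h
  refine ⟨φ.symm, fun e => ?_⟩
  rw [← hφ]
  exact congrArg Δ.sign (φ.mapEdgeSet.apply_symm_apply e)

theorem exists_isomorphic_disjUnion {W : Type*} (Γ : SignedGraph W)
    (ψ : graphUnion G ≃g Γ.graph) :
    ∃ σ : ∀ i, (G i).edgeSet → ℤˣ, Γ.Isomorphic (disjUnion fun i => ⟨G i, σ i⟩) := by
  let σ (i : ι) (e : (G i).edgeSet) : ℤˣ :=
    Γ.sign (ψ.mapEdgeSet ((graphUnionEmbedding G i).mapEdgeSet e))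
  refine ⟨σ, Isomorphic.symm ⟨ψ, ?_⟩⟩
  rintro ⟨e, he⟩
  obtain ⟨⟨i, e⟩, rfl⟩ := exists_of_mem_graphUnion ⟨e, he⟩
  exact (disjUnion_sign (fun i => ⟨G i, σ i⟩) i e he).symm

end DisjUnion

end SignedGraph

namespace SignedGraph

open SimpleGraph

theorem walkSign_eq_prod_of_isEulerian {V : Type*} [DecidableEq V] (Γ : SignedGraph V)
    [Fintype Γ.graph.edgeSet] {u v : V} {p : Γ.graph.Walk u v} (hp : p.IsEulerian) :
    Γ.walkSign p = ∏ e, Γ.sign e := by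
  let edges : List Γ.graph.edgeSet := p.darts.map fun d => ⟨d.edge, d.edge_mem⟩
  have hval : edges.map Subtype.val = p.edges := List.map_map
  have hnodup : edges.Nodup := (hval ▸ hp.isTrail.edges_nodup).of_map _
  have huniv : edges.toFinset = Finset.univ := by
    refine Finset.eq_univ_of_forall fun e => List.mem_toFinset.2 ?_
    rw [← List.mem_map_of_injective Subtype.val_injective, hval]
    exact hp.mem_edges_iff.2 e.2
  rw [← huniv, List.prod_toFinset _ hnodup, List.map_map]
  rfl

theorem balanced_iff_prod_sign_eq_one {V : Type*} [Finite V] (Γ : SignedGraph V)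
    [Fintype Γ.graph.edgeSet] (hG : Γ.graph.Connected)
    (hdeg : ∀ v, (Γ.graph.neighborSet v).ncard = 2) :
    Γ.Balanced ↔ ∏ e, Γ.sign e = 1 := by
  classical
  have hsign {v : V} {p : Γ.graph.Walk v v} (hp : p.IsCycle) : Γ.walkSign p = ∏ e, Γ.sign e :=
    Γ.walkSign_eq_prod_of_isEulerian (isEulerian_of_isCycle hG (fun v => (hdeg v).le) hp)
  constructor
  · intro h
    obtain ⟨v, p, hp⟩ := exists_isCycle_of_two_le_ncard_neighborSet hG fun v => (hdeg v).ge
    exact (hsign hp).symm.trans (h v p hp)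
  · exact fun h v p hp => (hsign hp).trans h

theorem intCast_units_mul_self (s : ℤˣ) : ((s : ℤ) : ℝ) * ((s : ℤ) : ℝ) = 1 := by
  rw [← Int.cast_mul, ← Units.val_mul, Int.units_mul_self, Units.val_one, Int.cast_one]

section Cycle

open scoped Fin.NatCast

variable {m : ℕ}

theorem cycleGraph_adj_add_one (i : Fin (m + 3)) : (cycleGraph (m + 3)).Adj i (i + 1) := by
  simp only [cycleGraph_adj, add_sub_cancel_left, or_true]

theorem cycleGraph_adj_iff_eq_add_one {i j : Fin (m + 3)} :
    (cycleGraph (m + 3)).Adj i j ↔ i = j + 1 ∨ j = i + 1 := by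
  rw [cycleGraph_adj, sub_eq_iff_eq_add', sub_eq_iff_eq_add']

theorem natCast_add_card (k : ℕ) : ((k + (m + 3) : ℕ) : Fin (m + 3)) = k :=
  Fin.ext (by simp only [Fin.val_natCast, Nat.add_mod_right])

theorem add_two_ne_self (i : Fin (m + 3)) : i + 2 ≠ i := by
  rw [Ne, add_eq_left, Fin.ext_iff, Fin.val_two]
  exact two_ne_zero

variable (σ : (cycleGraph (m + 3)).edgeSet → ℤˣ)

/-- The sign of the edge of a signed cycle joining `i` to `i + 1`. -/
def cycleSign (i : Fin (m + 3)) : ℤˣ := σ ⟨s(i, i + 1), cycleGraph_adj_add_one i⟩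

theorem prod_sign_cycle : ∏ e, σ e = ∏ i, cycleSign σ i := by
  let edge (i : Fin (m + 3)) : (cycleGraph (m + 3)).edgeSet :=
    ⟨s(i, i + 1), cycleGraph_adj_add_one i⟩
  refine (Fintype.prod_bijective edge ⟨fun i j hij => ?_, ?_⟩ _ _ fun _ => rfl).symm
  · rcases Sym2.eq_iff.1 (congrArg Subtype.val hij) with ⟨h, -⟩ | ⟨h, h'⟩
    · exact h
    · rw [h, add_assoc, one_add_one_eq_two] at h'
      exact absurd h' (add_two_ne_self j)
  · rintro ⟨e, he⟩
    induction e using Sym2.ind with | _ i j =>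
    rcases cycleGraph_adj_iff_eq_add_one.1 he with h | h
    · exact ⟨j, Subtype.ext (Sym2.eq_swap.trans (congrArg (s(·, j)) h.symm))⟩
    · exact ⟨i, Subtype.ext (congrArg (s(i, ·)) h.symm)⟩

theorem balanced_cycle_iff : (cycle (m + 3) σ).Balanced ↔ ∏ i, cycleSign σ i = 1 := by
  rw [← prod_sign_cycle]
  exact @balanced_iff_prod_sign_eq_one _ _ (cycle (m + 3) σ)
    (inferInstanceAs (Fintype (cycleGraph (m + 3)).edgeSet)) cycleGraph_connected
    (ncard_neighborSet_cycleGraph (Nat.le_add_left 3 m))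

theorem mulVec_adjMatrix_cycle (x : Fin (m + 3) → ℝ) (i : Fin (m + 3)) :
    (cycle (m + 3) σ).adjMatrix.mulVec x (i + 1) =
      ((cycleSign σ i : ℤ) : ℝ) * x i + ((cycleSign σ (i + 1) : ℤ) : ℝ) * x (i + 2) := by
  have hadd : i + 2 = i + 1 + 1 := by rw [add_assoc, one_add_one_eq_two]
  have hprev : (cycle (m + 3) σ).adjMatrix (i + 1) i = ((cycleSign σ i : ℤ) : ℝ) := by
    rw [adjMatrix_apply_of_adj _ (cycleGraph_adj_add_one i).symm]
    exact congrArg (fun s : ℤˣ => ((s : ℤ) : ℝ)) (congrArg σ (Subtype.ext Sym2.eq_swap))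
  have hnext : (cycle (m + 3) σ).adjMatrix (i + 1) (i + 2) = ((cycleSign σ (i + 1) : ℤ) : ℝ) := by
    rw [hadd]
    exact adjMatrix_apply_of_adj _ (cycleGraph_adj_add_one (i + 1))
  rw [← hprev, ← hnext, Matrix.mulVec, dotProduct]
  refine Fintype.sum_eq_add i (i + 2) (add_two_ne_self i).symm fun j hj => ?_
  rw [adjMatrix_apply_of_not_adj, zero_mul]
  intro h
  rcases cycleGraph_adj_iff_eq_add_one.1 h with h | h
  · exact hj.1 (add_right_cancel h).symm
  · exact hj.2 (h.trans hadd.symm)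

/-- The product of the signs of the edges along the walk `0, 1, …, k` around a signed cycle.
Multiplying by it switches all these signs to `1`. -/
def cyclePotential (k : ℕ) : ℤˣ := ∏ j ∈ Finset.range k, cycleSign σ (j : Fin (m + 3))

theorem cyclePotential_add_card (k : ℕ) :
    cyclePotential σ (k + (m + 3)) = (∏ i, cycleSign σ i) * cyclePotential σ k := by
  rw [cyclePotential, add_comm k, Finset.prod_range_add, Finset.prod_range]
  simp only [Fin.cast_val_eq_self, add_comm (m + 3), natCast_add_card, cyclePotential]

/-- A vector on the vertices of a signed cycle, unrolled to a sequence and switched by the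
potential. -/
def switchedSeq (x : Fin (m + 3) → ℝ) (k : ℕ) : ℝ := ((cyclePotential σ k : ℤ) : ℝ) * x k

theorem switchedSeq_add_card (x : Fin (m + 3) → ℝ) (k : ℕ) :
    switchedSeq σ x (k + (m + 3)) = (((∏ i, cycleSign σ i : ℤˣ) : ℤ) : ℝ) * switchedSeq σ x k := by
  rw [switchedSeq, switchedSeq, cyclePotential_add_card, natCast_add_card, Units.val_mul,
    Int.cast_mul, mul_assoc]

theorem exists_switchedSeq_eq {Y : ℕ → ℝ}
    (hY : ∀ k, Y (k + (m + 3)) = (((∏ i, cycleSign σ i : ℤˣ) : ℤ) : ℝ) * Y k) :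
    ∃ x, switchedSeq σ x = Y := by
  let X (k : ℕ) : ℝ := ((cyclePotential σ k : ℤ) : ℝ) * Y k
  have hX : Function.Periodic X (m + 3) := fun k => by
    simp only [X]
    rw [cyclePotential_add_card, hY, Units.val_mul, Int.cast_mul, mul_mul_mul_comm,
      intCast_units_mul_self, one_mul]
  refine ⟨fun i => X i, funext fun k => ?_⟩
  rw [switchedSeq, Fin.val_natCast, hX.map_mod_nat, ← mul_assoc, intCast_units_mul_self, one_mul]

theorem cyclePotential_mul_mulVec_adjMatrix_cycle (x : Fin (m + 3) → ℝ) (k : ℕ) :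
    ((cyclePotential σ (k + 1) : ℤ) : ℝ) * (cycle (m + 3) σ).adjMatrix.mulVec x (k + 1) =
      switchedSeq σ x k + switchedSeq σ x (k + 2) := by
  have hsucc (k : ℕ) : ((cyclePotential σ (k + 1) : ℤ) : ℝ) =
      ((cyclePotential σ k : ℤ) : ℝ) * ((cycleSign σ k : ℤ) : ℝ) := by
    rw [cyclePotential, Finset.prod_range_succ, ← cyclePotential, Units.val_mul, Int.cast_mul]
  have hsq := intCast_units_mul_self (cycleSign σ k)
  rw [mulVec_adjMatrix_cycle, switchedSeq, switchedSeq, hsucc (k + 1), hsucc]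
  push_cast
  linear_combination ((cyclePotential σ k : ℤ) : ℝ) * x k * hsq

theorem mulVec_adjMatrix_cycle_eq_zero_iff (x : Fin (m + 3) → ℝ) :
    (cycle (m + 3) σ).adjMatrix.mulVec x = 0 ↔ Function.Antiperiodic (switchedSeq σ x) 2 := by
  have hrow (k : ℕ) : (cycle (m + 3) σ).adjMatrix.mulVec x (k + 1) = 0 ↔
      switchedSeq σ x (k + 2) = -switchedSeq σ x k := by
    rw [eq_neg_iff_add_eq_zero, add_comm (switchedSeq σ x _),
      ← cyclePotential_mul_mulVec_adjMatrix_cycle,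
      mul_eq_zero_iff_left (Int.cast_ne_zero.2 (Units.ne_zero _))]
  refine ⟨fun h k => (hrow k).1 (congrFun h _), fun h => funext fun i => ?_⟩
  have hi := (hrow (i - 1 : Fin (m + 3))).2 (h _)
  rwa [Fin.cast_val_eq_self, sub_add_cancel] at hi

theorem isZeroForcing_cycleGraph :
    IsZeroForcing (cycleGraph (m + 3)) (({0, 1} : Finset (Fin (m + 3))) : Set (Fin (m + 3))) := by
  have hforced (k : ℕ) : ZeroForced (cycleGraph (m + 3)) (({0, 1} : Finset (Fin (m + 3))) : Set _)
      (k : Fin (m + 3)) ∧ ZeroForced (cycleGraph (m + 3)) (({0, 1} : Finset (Fin (m + 3))) : Set _)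
      ((k : Fin (m + 3)) + 1) := by
    induction k with
    | zero => exact ⟨.of_mem (by simp), .of_mem (by simp)⟩
    | succ k ih =>
      rw [Nat.cast_succ]
      refine ⟨ih.2, ih.2.force (cycleGraph_adj_add_one _) fun w hw hne => ?_⟩
      have hw : (k : Fin (m + 3)) = w :=
        add_right_cancel ((cycleGraph_adj_iff_eq_add_one.1 hw).resolve_right hne)
      exact hw ▸ ih.1
  exact fun i => Fin.cast_val_eq_self i ▸ (hforced i).1

theorem nullity_cycle_le_two {n : ℕ} (hn : 3 ≤ n) (σ : (cycleGraph n).edgeSet → ℤˣ) :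
    (cycle n σ).nullity ≤ 2 := by
  obtain ⟨m, rfl⟩ := Nat.exists_eq_add_of_le' hn
  exact (nullity_le_card_of_isZeroForcing (Γ := cycle (m + 3) σ) isZeroForcing_cycleGraph).trans
    Finset.card_le_two

theorem nullity_cycle_eq_two_iff_forall_exists :
    (cycle (m + 3) σ).nullity = 2 ↔ ∀ a b : ℝ, ∃ Y : ℕ → ℝ, Function.Antiperiodic Y 2 ∧
      (∀ k, Y (k + (m + 3)) = (((∏ i, cycleSign σ i : ℤˣ) : ℤ) : ℝ) * Y k) ∧ Y 0 = a ∧ Y 1 = b := by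
  have hcard : ({0, 1} : Finset (Fin (m + 3))).card = 2 := Finset.card_pair zero_ne_one
  have hzero (x : Fin (m + 3) → ℝ) : switchedSeq σ x 0 = x 0 := by
    simp [switchedSeq, cyclePotential]
  have hone (x : Fin (m + 3) → ℝ) : switchedSeq σ x 1 = ((cycleSign σ 0 : ℤ) : ℝ) * x 1 := by
    simp [switchedSeq, cyclePotential]
  have hsq := intCast_units_mul_self (cycleSign σ 0)
  rw [nullity_eq_finrank, ← hcard, isZeroForcing_cycleGraph.finrank_ker_eq_card_iff
    fun v w _ => (cycle (m + 3) σ).adjMatrix_ne_zero_iff v w]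
  simp only [mulVec_adjMatrix_cycle_eq_zero_iff, Finset.forall_mem_insert, Finset.mem_singleton,
    forall_eq]
  constructor
  · intro h a b
    obtain ⟨x, hx, hx0, hx1⟩ := h fun i => if i = 0 then a else ((cycleSign σ 0 : ℤ) : ℝ) * b
    refine ⟨switchedSeq σ x, hx, switchedSeq_add_card σ x, (hzero x).trans hx0, ?_⟩
    rw [hone, hx1, if_neg one_ne_zero, ← mul_assoc, hsq, one_mul]
  · intro h y
    obtain ⟨Y, hY, hcard, hY0, hY1⟩ := h (y 0) (((cycleSign σ 0 : ℤ) : ℝ) * y 1)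
    obtain ⟨x, rfl⟩ := exists_switchedSeq_eq σ hcard
    rw [hzero] at hY0
    rw [hone] at hY1
    exact ⟨x, hY, hY0, mul_left_cancel₀ (left_ne_zero_of_mul_eq_one hsq) hY1⟩

end Cycle

theorem forall_exists_antiperiodic_iff {K : Type*} [Field K] {c : K} (hc : c ≠ 0) (n : ℕ) :
    (∀ a b : K, ∃ Y : ℕ → K, Function.Antiperiodic Y 2 ∧ (∀ k, Y (k + n) = c * Y k) ∧
      Y 0 = a ∧ Y 1 = b) ↔ ∃ l, n = 2 * l ∧ c = (-1) ^ l := by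
  constructor
  · intro h
    obtain ⟨Y, hanti, hclosed, h0, h1⟩ := h 1 0
    have hn : Y n = c := by simpa only [zero_add, h0, mul_one] using hclosed 0
    rcases Nat.even_or_odd' n with ⟨l, rfl | rfl⟩
    · have heven := hanti.add_nat_mul_eq (x := 0) l
      rw [Nat.cast_id, zero_add, mul_comm l, hn, h0, mul_one] at heven
      exact ⟨l, rfl, heven⟩
    · have hodd := hanti.add_nat_mul_eq (x := 1) l
      rw [Nat.cast_id, add_comm, mul_comm l, hn, h1, mul_zero] at hodd
      exact absurd hodd hc
  · rintro ⟨l, rfl, rfl⟩ a b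
    have hanti : Function.Antiperiodic
        (fun k : ℕ => (-1 : K) ^ (k / 2) * if Even k then a else b) 2 := fun k => by
      simp only [Nat.add_div_right k two_pos, pow_succ, Nat.even_add, even_two, iff_true, mul_neg,
        mul_one, neg_mul]
    exact ⟨_, hanti, fun k => mul_comm 2 l ▸ hanti.add_nat_mul_eq l, by simp, by simp⟩

theorem exists_eq_two_mul_and_eq_neg_one_pow_iff (n : ℕ) (s : ℤˣ) :
    (∃ l, n = 2 * l ∧ s = (-1) ^ l) ↔ (s = 1 → n ≡ 0 [MOD 4]) ∧ (s ≠ 1 → n ≡ 2 [MOD 4]) := by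
  have hparity (l : ℕ) : s = (-1) ^ l ↔ (s = 1 ↔ Even l) := by
    have hne : (-1 : ℤˣ) ≠ 1 := by decide
    rcases Int.units_eq_one_or s with rfl | rfl
    · rw [eq_comm, neg_one_pow_eq_one_iff_even hne, eq_self, true_iff]
    · rw [eq_comm, neg_one_pow_eq_neg_one_iff_odd hne, iff_false_left hne, Nat.not_even_iff_odd]
  simp only [hparity, Nat.ModEq]
  by_cases hs : s = 1
  · simp only [hs, true_iff, forall_const, ne_eq, not_true_eq_false, false_imp_iff, and_true]
    exact ⟨fun ⟨l, hl, k, hk⟩ => by omega, fun h => ⟨2 * (n / 4), by omega, even_two_mul _⟩⟩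
  · simp only [hs, false_iff, false_imp_iff, true_and, ne_eq, not_false_eq_true, forall_const,
      Nat.not_even_iff_odd]
    exact ⟨fun ⟨l, hl, k, hk⟩ => by omega,
      fun h => ⟨2 * (n / 4) + 1, by omega, odd_two_mul_add_one _⟩⟩

theorem nullity_cycle_eq_two_iff {n : ℕ} (hn : 3 ≤ n) (σ : (cycleGraph n).edgeSet → ℤˣ) :
    (cycle n σ).nullity = 2 ↔
      ((cycle n σ).Balanced → n ≡ 0 [MOD 4]) ∧ (¬ (cycle n σ).Balanced → n ≡ 2 [MOD 4]) := by
  obtain ⟨m, rfl⟩ := Nat.exists_eq_add_of_le' hn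
  rw [nullity_cycle_eq_two_iff_forall_exists, balanced_cycle_iff,
    ← exists_eq_two_mul_and_eq_neg_one_pow_iff,
    forall_exists_antiperiodic_iff (Int.cast_ne_zero.2 (Units.ne_zero _))]
  refine exists_congr fun l => and_congr_right fun _ => ?_
  rw [Units.ext_iff, ← Int.cast_inj (α := ℝ), Units.val_pow_eq_pow_val, Units.val_neg,
    Units.val_one, Int.cast_pow, Int.cast_neg, Int.cast_one]

end SignedGraph

theorem degree_pos_of_two_le_ncard_supp {V : Type*} {G : SimpleGraph V} (v : V)
    [Fintype (G.neighborSet v)] (hv : 2 ≤ (G.connectedComponentMk v).supp.ncard) :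
    0 < G.degree v := by
  obtain ⟨w, hw, hne⟩ := Set.exists_ne_of_one_lt_ncard hv v
  obtain ⟨p⟩ : G.Reachable v w := (SimpleGraph.ConnectedComponent.exact hw).symm
  exact (G.degree_pos_iff_exists_adj v).2 ⟨p.snd, p.adj_snd (p.not_nil_of_ne hne.symm)⟩

namespace SignedGraph

open SimpleGraph

section Bound

variable {V : Type*} [Fintype V] (Γ : SignedGraph V) [DecidableRel Γ.graph.Adj]

theorem numPendant_add_two_mul_cyclomaticNumber (hpos : ∀ v, 0 < Γ.graph.degree v) :
    (Γ.numPendant : ℤ) + 2 * Γ.cyclomaticNumber =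
      ((2 * Nat.card Γ.graph.ConnectedComponent + ∑ v, (Γ.graph.degree v - 2) : ℕ) : ℤ) := by
  have hsum := sum_degree_sub_two_add hpos
  have hpendant : Γ.numPendant = (Finset.univ.filter fun v => Γ.graph.degree v = 1).card := by
    rw [numPendant, ← Fintype.card_subtype, ← Nat.card_eq_fintype_card]
    simp only [degree_eq_ncard_neighborSet]
  have hedge : Nat.card Γ.graph.edgeSet = Γ.graph.edgeFinset.card := by
    rw [Nat.card_eq_fintype_card, edgeFinset_card]
  rw [cyclomaticNumber, hpendant, hedge, Nat.card_eq_fintype_card (α := V)]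
  zify at hsum ⊢
  linarith

theorem numPendant_add_two_mul_cyclomaticNumber_of_degree_eq_two
    (hdeg : ∀ v, Γ.graph.degree v = 2) :
    (Γ.numPendant : ℤ) + 2 * Γ.cyclomaticNumber =
      ((2 * Nat.card Γ.graph.ConnectedComponent : ℕ) : ℤ) := by
  rw [Γ.numPendant_add_two_mul_cyclomaticNumber fun v => (hdeg v).symm ▸ two_pos]
  simp only [hdeg, Nat.sub_self, Finset.sum_const_zero, add_zero]

theorem degree_eq_two_of_le_nullity [DecidableEq V] (hpos : ∀ v, 0 < Γ.graph.degree v)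
    (h : (Γ.numPendant : ℤ) + 2 * Γ.cyclomaticNumber ≤ Γ.nullity) (v : V) :
    Γ.graph.degree v = 2 := by
  by_contra hv
  obtain ⟨S, hS, hcard⟩ := exists_isZeroForcing_card_lt hpos hv
  rw [Γ.numPendant_add_two_mul_cyclomaticNumber hpos, Nat.cast_le] at h
  exact (h.trans (nullity_le_card_of_isZeroForcing hS)).not_gt hcard

end Bound

section CycleUnion

variable {V : Type*} {Γ : SignedGraph V} {t : ℕ} {n : Fin t → ℕ}

theorem card_eq_sum_of_iso_graphUnion_cycleGraph [Fintype V]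
    (φ : Γ.graph ≃g graphUnion fun i => cycleGraph (n i)) : ∑ i, n i = Fintype.card V := by
  rw [Fintype.card_congr φ.toEquiv, Fintype.card_sigma]
  simp only [Fintype.card_fin]

theorem card_connectedComponent_of_iso_graphUnion_cycleGraph (hn : ∀ i, 3 ≤ n i)
    (φ : Γ.graph ≃g graphUnion fun i => cycleGraph (n i)) :
    Nat.card Γ.graph.ConnectedComponent = t := by
  have hconn (i : Fin t) : (cycleGraph (n i)).Connected := by
    obtain ⟨m, hm⟩ := Nat.exists_eq_add_of_le' (hn i)
    exact hm ▸ cycleGraph_connected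
  rw [Nat.card_congr φ.connectedComponentEquiv, card_connectedComponent_graphUnion hconn,
    Nat.card_fin]

theorem degree_eq_two_of_iso_graphUnion_cycleGraph (hn : ∀ i, 3 ≤ n i)
    (φ : Γ.graph ≃g graphUnion fun i => cycleGraph (n i)) (v : V)
    [Fintype (Γ.graph.neighborSet v)] : Γ.graph.degree v = 2 := by
  rw [degree_eq_ncard_neighborSet, ← Nat.card_coe_set_eq, Nat.card_congr (φ.mapNeighborSet v),
    Nat.card_coe_set_eq]
  exact (ncard_neighborSet_graphUnion _ _).trans (ncard_neighborSet_cycleGraph (hn _) _)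

theorem nullity_eq_iff_of_isomorphic_disjUnion_cycle [Fintype V] [DecidableEq V]
    {σ : ∀ i, (cycleGraph (n i)).edgeSet → ℤˣ} (hn : ∀ i, 3 ≤ n i)
    (hΓ : Γ.Isomorphic (disjUnion fun i => cycle (n i) (σ i))) :
    (Γ.nullity : ℤ) = Γ.numPendant + 2 * Γ.cyclomaticNumber ↔
      ∀ i, (cycle (n i) (σ i)).nullity = 2 := by
  classical
  obtain ⟨φ, -⟩ := id hΓ
  have htwo : 2 * t = ∑ _i : Fin t, 2 := by
    rw [Finset.sum_const, Finset.card_univ, Fintype.card_fin, smul_eq_mul, mul_comm]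
  rw [Γ.numPendant_add_two_mul_cyclomaticNumber_of_degree_eq_two
      (degree_eq_two_of_iso_graphUnion_cycleGraph hn φ ·), Nat.cast_inj,
    card_connectedComponent_of_iso_graphUnion_cycleGraph hn φ, hΓ.nullity_eq, nullity_disjUnion,
    htwo, Finset.sum_eq_sum_iff_of_le fun i _ => nullity_cycle_le_two (hn i) (σ i)]
  simp only [Finset.mem_univ, forall_const]

end CycleUnion

end SignedGraph

theorem corollary4p2 {V : Type*} [Fintype V] [DecidableEq V] (Γ : SignedGraph V)
    (hΓ : ∀ c : Γ.graph.ConnectedComponent, 2 ≤ c.supp.ncard) :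
    (Γ.nullity : ℤ) = Γ.numPendant + 2 * Γ.cyclomaticNumber ↔
      ∃ (t : ℕ) (n : Fin t → ℕ)
        (σ : ∀ i : Fin t, (SimpleGraph.cycleGraph (n i)).edgeSet → ℤˣ),
        (∀ i, 3 ≤ n i) ∧
        ∑ i, n i = Fintype.card V ∧
        Γ.Isomorphic (SignedGraph.disjUnion fun i => SignedGraph.cycle (n i) (σ i)) ∧
        ∀ i, ((SignedGraph.cycle (n i) (σ i)).Balanced → n i ≡ 0 [MOD 4]) ∧
          (¬ (SignedGraph.cycle (n i) (σ i)).Balanced → n i ≡ 2 [MOD 4]) := by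
  classical
  constructor
  · intro h
    have hdeg (v : V) : (Γ.graph.neighborSet v).ncard = 2 := by
      rw [← degree_eq_ncard_neighborSet]
      exact Γ.degree_eq_two_of_le_nullity (fun v => degree_pos_of_two_le_ncard_supp v (hΓ _))
        h.ge v
    obtain ⟨t, n, hn, ⟨φ⟩⟩ := SignedGraph.exists_iso_graphUnion_cycleGraph Γ.graph hdeg
    obtain ⟨σ, hσ⟩ := Γ.exists_isomorphic_disjUnion φ
    exact ⟨t, n, σ, hn, SignedGraph.card_eq_sum_of_iso_graphUnion_cycleGraph φ.symm, hσ, fun i =>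
      (SignedGraph.nullity_cycle_eq_two_iff (hn i) (σ i)).1
        ((SignedGraph.nullity_eq_iff_of_isomorphic_disjUnion_cycle hn hσ).1 h i)⟩
  · rintro ⟨t, n, σ, hn, -, hσ, hmod⟩
    exact (SignedGraph.nullity_eq_iff_of_isomorphic_disjUnion_cycle hn hσ).2 fun i =>
      (SignedGraph.nullity_cycle_eq_two_iff (hn i) (σ i)).2 (hmod i)
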